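/- Let $0<\alpha\le 2$, $\beta>0$, $|\gamma|\le 1$, $\Sigma=\begin{pmatrix}1&\gamma\\ \gamma&1\end{pmatrix}$, and let $(X_1,X_2)$ be a bivariate Linnik random vector, that is, a random vector with characteristic function $$E\big[e^{i(t_1X_1+t_2X_2)}\big]=\{1+(\boldsymbol t'\Sigma\boldsymbol t)^{\alpha/2}\}^{-\beta},\qquad \boldsymbol t=(t_1,t_2)'\in\mathbb R^2 .$$ Then $E[X_2\mid X_1]=\gamma X_1$ almost surely. Here the conditional expectation is the mean of the regular conditional distribution of $X_2$ given $X_1$, which is almost surely finite; if $\alpha>1$, then $X_2$ is integrable and this is the usual conditional expectation. Moreover, if $1<\alpha<2$ and $1<1+\lambda<\alpha$, then for every $c\in\mathbb R$ the moment $E[|X_2-cX_1|^{1+\lambda}]$ is finite and $$E\big[|X_2-cX_1|^{1+\lambda}\big]=\frac{\lambda\beta}{\sin(\frac{\lambda\pi}{2})\,\Gamma(1-\lambda)}\,|c^2-2\gamma c+1|^{\frac{1+\lambda}{2}}\,B\Big(1-\frac{1+\lambda}{\alpha},\,\beta+\frac{1+\lambda}{\alpha}\Big),$$ and therefore $$E\big[|X_2-E[X_2\mid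 X_1]|^{1+\lambda}\big]=\frac{\lambda\beta}{\sin(\frac{\lambda\pi}{2})\,\Gamma(1-\lambda)}\,(1-\gamma^2)^{\frac{1+\lambda}{2}}\,B\Big(1-\frac{1+\lambda}{\alpha},\,\beta+\frac{1+\lambda}{\alpha}\Big),$$ where $\Gamma$ is the gamma function and $B$ the beta function. -/

import Mathlib

open MeasureTheory ProbabilityTheory
open scoped Matrix

/-- The correlation matrix with unit diagonal and off-diagonal entry `γ`. -/
def corrMatrix (γ : ℝ) : Matrix (Fin 2) (Fin 2) ℝ :=
  !![1, γ; γ, 1]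

/-- `(X₁, X₂)` is a bivariate Linnik random vector with parameters `α`, `β` and matrix `S`:
its characteristic function is `t ↦ (1 + (t' S t) ^ (α / 2)) ^ (-β)`. -/
structure IsBivariateLinnik {Ω : Type*} [MeasurableSpace Ω] (P : Measure Ω)
    (X₁ X₂ : Ω → ℝ) (α β : ℝ) (S : Matrix (Fin 2) (Fin 2) ℝ) : Prop where
  measurable_fst : Measurable X₁
  measurable_snd : Measurable X₂
  charFun_eq : ∀ t : EuclideanSpace ℝ (Fin 2),
    charFun (P.map (fun ω => !₂[X₁ ω, X₂ ω])) t =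
      (((1 + ((t : Fin 2 → ℝ) ⬝ᵥ (S *ᵥ (t : Fin 2 → ℝ))) ^ (α / 2)) ^ (-β) : ℝ) : ℂ)

/-!
The argument works in the coordinates `X₁` and `D = X₂ - γ X₁`, in which the quadratic form of the
characteristic function is diagonal: `(X₁, D)` has characteristic function
`(1 + (s ^ 2 + (1 - γ ^ 2) * u ^ 2) ^ (α / 2)) ^ (-β)`.

**Conditional mean.** The law of `(X₁, D)` is unchanged by `D ↦ -D`, so `D` has conditional mean
zero given `X₁` as soon as the conditional law is integrable. For `α ≤ 1` this is not a consequence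
of moments of `D`. If `|γ| < 1`, rescaling `D` gives a rotation invariant pair `(A, W)`, and
averaging over rotations shows `E[|W| / (1 + A ^ 2)] ≤ 1`: along a circle of radius `r` the
integrand is the speed of `arctan (r * cos θ)`, whose total variation over a period is at most
`2 * π` (`integral_abs_sin_div_le`, `integrable_div_one_add_sq_of_rotation_invariant`). If `|γ| = 1`, then
`D = 0` almost surely. Damping by a function of `X₁` does not affect conditional integrability, and
`condDistrib_mean_of_symm` concludes.

**Moments.** For `1 < p < 2`, `|y| ^ p` is proportional to
`∫ t in Ioi 0, (1 - cos (t * y)) * t ^ (-1 - p)`, so that `E[|Y| ^ p]` is proportional to the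
integral of `(1 - φ t) * t ^ (-1 - p)`, where `φ` is the real part of the characteristic function
of `Y` (`lintegral_abs_rpow_mul_eq`). For `Y = X₂ - c X₁` one has `φ t = (1 + |σ t| ^ α) ^ (-β)`
with `σ ^ 2 = c ^ 2 - 2 * γ * c + 1`, and `setLIntegral_Ioi_one_sub_mul_rpow` evaluates the integral
as a beta function. The constant of proportionality comes from the same computation with `α = 2`
and `β = 1`, the Laplace law, whose absolute moments are Gamma values. All integrands are
nonnegative and all exchanges of integrals are made for `∫⁻`, so finiteness of the moments is
a consequence of the formula.
-/

section

open Set Real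

/-! ### Integrals over the half-line and absolute moments -/

theorem setLIntegral_Ioi_comp_mul_mul_rpow (h : ℝ → ℝ) (p : ℝ) {c : ℝ} (hc : 0 < c) :
    ∫⁻ t in Ioi (0 : ℝ), ENNReal.ofReal (h (c * t) * t ^ (-1 - p)) =
      ENNReal.ofReal (c ^ p) * ∫⁻ t in Ioi (0 : ℝ), ENNReal.ofReal (h t * t ^ (-1 - p)) := by
  have himg : (fun t : ℝ => c * t) '' Ioi 0 = Ioi 0 := by
    rw [image_mul_left_Ioi hc, mul_zero]
  have hsub := lintegral_image_eq_lintegral_abs_deriv_mul (s := Ioi (0 : ℝ)) measurableSet_Ioi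
    (f := fun t => c * t) (f' := fun _ => c)
    (fun t _ => by simpa using ((hasDerivAt_id t).const_mul c).hasDerivWithinAt)
    (fun a _ b _ hab => mul_left_cancel₀ hc.ne' hab)
    (fun t => ENNReal.ofReal (h t * t ^ (-1 - p)))
  rw [himg] at hsub
  rw [hsub, ← lintegral_const_mul' _ _ ENNReal.ofReal_ne_top]
  refine setLIntegral_congr_fun measurableSet_Ioi fun t ht => ?_
  have ht : 0 < t := ht
  rw [← ENNReal.ofReal_mul (abs_nonneg c), ← ENNReal.ofReal_mul (by positivity), abs_of_pos hc,
    mul_rpow hc.le ht.le]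
  congr 1
  have : c ^ p * c * c ^ (-1 - p) = 1 := by
    rw [← rpow_add_one hc.ne', ← rpow_add hc, show p + 1 + (-1 - p) = 0 by ring, rpow_zero]
  linear_combination (-(h (c * t) * t ^ (-1 - p))) * this

theorem setLIntegral_Ioi_rpow_neg_one_sub {p s : ℝ} (hp : 0 < p) (hs : 0 < s) :
    ∫⁻ t in Ioi s, ENNReal.ofReal (t ^ (-1 - p)) = ENNReal.ofReal (s ^ (-p) / p) := by
  rw [← ofReal_integral_eq_lintegral_ofReal (integrableOn_Ioi_rpow_of_lt (by linarith) hs),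
    integral_Ioi_rpow_of_lt (by linarith) hs]
  · congr 1
    rw [show -1 - p + 1 = -p by ring, div_neg, neg_div, neg_neg]
  · filter_upwards [ae_restrict_mem measurableSet_Ioi] with t ht
    have : 0 < t := hs.trans ht
    positivity

theorem setLIntegral_Ioi_rpow_mul_exp_neg_mul {a r : ℝ} (ha : 0 < a) (hr : 0 < r) :
    ∫⁻ t in Ioi (0 : ℝ), ENNReal.ofReal (t ^ (a - 1) * exp (-(r * t))) =
      ENNReal.ofReal ((1 / r) ^ a * Gamma a) := by
  have hval := integral_rpow_mul_exp_neg_mul_Ioi ha hr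
  rw [← hval, ofReal_integral_eq_lintegral_ofReal]
  · refine not_imp_comm.1 integral_undef ?_
    rw [hval]
    have := Gamma_pos_of_pos ha
    positivity
  · filter_upwards [ae_restrict_mem measurableSet_Ioi] with t ht
    have : 0 < t := ht
    positivity

/-- The beta integral over the half-line. It follows by writing `(1 + s) ^ (-(a + b))` as a Gamma
integral and exchanging the integrals. -/
theorem setLIntegral_Ioi_rpow_mul_one_add_rpow {a b : ℝ} (ha : 0 < a) (hb : 0 < b) :
    ∫⁻ s in Ioi (0 : ℝ), ENNReal.ofReal (s ^ (a - 1) * (1 + s) ^ (-(a + b))) =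
      ENNReal.ofReal (beta a b) := by
  have hG := Gamma_pos_of_pos (add_pos ha hb)
  have hGa := Gamma_pos_of_pos ha
  have hGb := Gamma_pos_of_pos hb
  have key : ENNReal.ofReal (Gamma (a + b)) *
      ∫⁻ s in Ioi (0 : ℝ), ENNReal.ofReal (s ^ (a - 1) * (1 + s) ^ (-(a + b))) =
      ENNReal.ofReal (Gamma a * Gamma b) := by
    calc _ = ∫⁻ s in Ioi (0 : ℝ), ∫⁻ y in Ioi (0 : ℝ),
          ENNReal.ofReal (s ^ (a - 1) * (y ^ (a + b - 1) * exp (-((1 + s) * y)))) := by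
          rw [← lintegral_const_mul' _ _ ENNReal.ofReal_ne_top]
          refine setLIntegral_congr_fun measurableSet_Ioi fun s hs => ?_
          have hs : 0 < s := hs
          have h1s : 0 < 1 + s := by linarith
          simp_rw [ENNReal.ofReal_mul (rpow_nonneg hs.le (a - 1))]
          rw [lintegral_const_mul' _ _ ENNReal.ofReal_ne_top,
            setLIntegral_Ioi_rpow_mul_exp_neg_mul (add_pos ha hb) h1s, one_div,
            inv_rpow h1s.le, ← rpow_neg h1s.le, ← ENNReal.ofReal_mul (by positivity),
            ← ENNReal.ofReal_mul (by positivity), ← ENNReal.ofReal_mul (by positivity)]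
          congr 1
          ring
      _ = ∫⁻ y in Ioi (0 : ℝ), ∫⁻ s in Ioi (0 : ℝ),
          ENNReal.ofReal (s ^ (a - 1) * (y ^ (a + b - 1) * exp (-((1 + s) * y)))) :=
          lintegral_lintegral_swap (by fun_prop)
      _ = ∫⁻ y in Ioi (0 : ℝ), ENNReal.ofReal (Gamma a) *
            ENNReal.ofReal (y ^ (b - 1) * exp (-(1 * y))) := by
          refine setLIntegral_congr_fun measurableSet_Ioi fun y hy => ?_
          have hy : 0 < y := hy
          have hsplit : ∀ s : ℝ, ENNReal.ofReal
              (s ^ (a - 1) * (y ^ (a + b - 1) * exp (-((1 + s) * y)))) =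
              ENNReal.ofReal (y ^ (a + b - 1) * exp (-y)) *
                ENNReal.ofReal (s ^ (a - 1) * exp (-(y * s))) := fun s => by
            rw [← ENNReal.ofReal_mul (by positivity),
              show -((1 + s) * y) = -y + -(y * s) by ring, exp_add]
            congr 1
            ring
          simp_rw [hsplit]
          rw [lintegral_const_mul' _ _ ENNReal.ofReal_ne_top,
            setLIntegral_Ioi_rpow_mul_exp_neg_mul ha hy, ← ENNReal.ofReal_mul (by positivity),
            ← ENNReal.ofReal_mul (by positivity), one_div, inv_rpow hy.le, ← rpow_neg hy.le,
            show b - 1 = (a + b - 1) + -a by ring, rpow_add hy, one_mul]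
          congr 1
          ring
      _ = _ := by
          rw [lintegral_const_mul' _ _ ENNReal.ofReal_ne_top,
            setLIntegral_Ioi_rpow_mul_exp_neg_mul hb one_pos, ← ENNReal.ofReal_mul hGa.le]
          simp
  have h0 : ENNReal.ofReal (Gamma (a + b)) ≠ 0 := by simpa using hG
  rw [← ENNReal.mul_right_inj h0 ENNReal.ofReal_ne_top, key, ← ENNReal.ofReal_mul hG.le, beta]
  congr 1
  field_simp

/-- The Mellin-type integral of `1 - (1 + t ^ α) ^ (-β)`: integration by parts, in the form of an
exchange of integrals, reduces it to the beta integral. -/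
theorem setLIntegral_Ioi_one_sub_mul_rpow {α β p : ℝ} (hβ : 0 < β) (hp : 0 < p) (hpα : p < α) :
    ∫⁻ t in Ioi (0 : ℝ), ENNReal.ofReal ((1 - (1 + t ^ α) ^ (-β)) * t ^ (-1 - p)) =
      ENNReal.ofReal (β / p * beta (1 - p / α) (β + p / α)) := by
  have hα : 0 < α := hp.trans hpα
  have hpα1 : p / α < 1 := (div_lt_one hα).2 hpα
  have hpα0 : 0 < p / α := by positivity
  have hFTC : ∀ x : ℝ, 0 < x → ENNReal.ofReal (1 - (1 + x) ^ (-β)) =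
      ∫⁻ s in Ioo 0 x, ENNReal.ofReal (β * (1 + s) ^ (-β - 1)) := by
    intro x hx
    have hd : ∀ s ∈ uIcc 0 x, HasDerivAt (fun s : ℝ => -(1 + s) ^ (-β))
        (β * (1 + s) ^ (-β - 1)) s := by
      intro s hs
      rw [uIcc_of_le hx.le] at hs
      have h1 : 1 + s ≠ 0 := by linarith [hs.1]
      have h2 : HasDerivAt (fun s : ℝ => 1 + s) 1 s := (hasDerivAt_id s).const_add 1
      exact (h2.rpow_const (Or.inl h1)).neg.congr_deriv (by ring)
    have hc : ContinuousOn (fun s : ℝ => β * (1 + s) ^ (-β - 1)) (uIcc 0 x) := by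
      refine ContinuousOn.mul continuousOn_const (ContinuousOn.rpow_const (by fun_prop) ?_)
      intro s hs
      rw [uIcc_of_le hx.le] at hs
      exact Or.inl (by linarith [hs.1])
    have hi := hc.intervalIntegrable (μ := volume)
    have hI := intervalIntegral.integral_eq_sub_of_hasDerivAt hd hi
    rw [intervalIntegral.integral_of_le hx.le] at hI
    rw [setLIntegral_congr Ioo_ae_eq_Ioc, ← ofReal_integral_eq_lintegral_ofReal
      ((intervalIntegrable_iff_integrableOn_Ioc_of_le hx.le).1 hi), hI]
    · congr 1
      simp
      ring
    · filter_upwards [ae_restrict_mem measurableSet_Ioc] with s hs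
      have : 0 < s := hs.1
      positivity
  calc _ = ∫⁻ t in Ioi (0 : ℝ), ∫⁻ s in Ioi (0 : ℝ), {q : ℝ × ℝ | q.2 < q.1 ^ α}.indicator
          (fun q => ENNReal.ofReal (β * (1 + q.2) ^ (-β - 1)) * ENNReal.ofReal (q.1 ^ (-1 - p)))
          (t, s) := by
        refine setLIntegral_congr_fun measurableSet_Ioi fun t ht => ?_
        have ht : 0 < t := ht
        rw [ENNReal.ofReal_mul' (by positivity), hFTC _ (by positivity),
          ← lintegral_mul_const' _ _ ENNReal.ofReal_ne_top, ← Ioi_inter_Iio, inter_comm,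
          ← setLIntegral_indicator measurableSet_Iio]
        rfl
    _ = ∫⁻ s in Ioi (0 : ℝ), ∫⁻ t in Ioi (0 : ℝ), {q : ℝ × ℝ | q.2 < q.1 ^ α}.indicator
          (fun q => ENNReal.ofReal (β * (1 + q.2) ^ (-β - 1)) * ENNReal.ofReal (q.1 ^ (-1 - p)))
          (t, s) := by
        refine lintegral_lintegral_swap (Measurable.aemeasurable ?_)
        exact Measurable.indicator (by fun_prop) (measurableSet_lt (by fun_prop) (by fun_prop))
    _ = ∫⁻ s in Ioi (0 : ℝ), ENNReal.ofReal (β / p) * ENNReal.ofReal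
          (s ^ (1 - p / α - 1) * (1 + s) ^ (-((1 - p / α) + (β + p / α)))) := by
        refine setLIntegral_congr_fun measurableSet_Ioi fun s hs => ?_
        have hs : 0 < s := hs
        have hset : Ioi (s ^ α⁻¹) = {t : ℝ | s < t ^ α} ∩ Ioi 0 := by
          ext t
          simp only [mem_Ioi, mem_inter_iff, mem_ofPred_eq]
          constructor
          · intro h
            have ht : 0 < t := (rpow_pos_of_pos hs _).trans h
            exact ⟨(rpow_inv_lt_iff_of_pos hs.le ht.le hα).1 h, ht⟩
          · rintro ⟨h, ht⟩
            exact (rpow_inv_lt_iff_of_pos hs.le ht.le hα).2 h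
        have hind : ∀ t : ℝ, {q : ℝ × ℝ | q.2 < q.1 ^ α}.indicator
          (fun q => ENNReal.ofReal (β * (1 + q.2) ^ (-β - 1)) * ENNReal.ofReal (q.1 ^ (-1 - p)))
          (t, s) = {t : ℝ | s < t ^ α}.indicator (fun t => ENNReal.ofReal
            (β * (1 + s) ^ (-β - 1)) * ENNReal.ofReal (t ^ (-1 - p))) t := fun _ => rfl
        simp_rw [hind]
        rw [setLIntegral_indicator (measurableSet_lt (by fun_prop) (by fun_prop)), ← hset,
          lintegral_const_mul' _ _ ENNReal.ofReal_ne_top,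
          setLIntegral_Ioi_rpow_neg_one_sub hp (by positivity),
          ← ENNReal.ofReal_mul (by positivity), ← ENNReal.ofReal_mul (by positivity),
          ← rpow_mul hs.le]
        congr 1
        rw [show α⁻¹ * -p = 1 - p / α - 1 by ring,
          show -((1 - p / α) + (β + p / α)) = -β - 1 by ring]
        ring
    _ = _ := by
        rw [lintegral_const_mul' _ _ ENNReal.ofReal_ne_top,
          setLIntegral_Ioi_rpow_mul_one_add_rpow (by linarith) (by positivity),
          ← ENNReal.ofReal_mul (by positivity)]

theorem setLIntegral_Ioi_exp_neg_mul_one_sub_cos (t : ℝ) :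
    ∫⁻ y in Ioi (0 : ℝ), ENNReal.ofReal (exp (-y) * (1 - cos (t * y))) =
      ENNReal.ofReal (1 - (1 + t ^ (2 : ℝ)) ^ (-1 : ℝ)) := by
  have hre : ((-1 : ℂ) + t * Complex.I).re < 0 := by simp
  have hint := integrableOn_exp_mul_complex_Ioi hre 0
  have hval := integral_exp_mul_complex_Ioi hre 0
  have hcos : ∀ y : ℝ, (Complex.exp (((-1 : ℂ) + t * Complex.I) * y)).re =
      exp (-y) * cos (t * y) := fun y => by
    rw [Complex.exp_re]
    simp
  have hint' : IntegrableOn (fun y : ℝ => exp (-y) * cos (t * y)) (Ioi 0) := by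
    have h := hint.re
    simp only [RCLike.re_eq_complex_re, hcos] at h
    exact h
  have hval' : ∫ y in Ioi (0 : ℝ), exp (-y) * cos (t * y) = (1 + t ^ 2)⁻¹ := by
    have h := congrArg Complex.re hval
    have h2 := integral_re hint
    simp only [RCLike.re_eq_complex_re, hcos] at h2
    rw [h2, h]
    simp [Complex.div_re, Complex.normSq_apply]
    ring
  have he : IntegrableOn (fun y : ℝ => exp (-y)) (Ioi 0) := by
    simpa using exp_neg_integrableOn_Ioi 0 one_pos
  have hfun : ∀ y : ℝ, exp (-y) * (1 - cos (t * y)) = exp (-y) - exp (-y) * cos (t * y) :=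
    fun y => by ring
  simp_rw [hfun]
  rw [← ofReal_integral_eq_lintegral_ofReal (f := fun y => exp (-y) - exp (-y) * cos (t * y))
    (he.sub hint'), integral_sub he hint', hval',
    integral_exp_neg_Ioi_zero]
  · norm_num [rpow_neg_one]
  · refine ae_of_all _ fun y => ?_
    simp only [Pi.zero_apply]
    rw [← hfun]
    exact mul_nonneg (exp_pos _).le (by linarith [cos_le_one (t * y)])

/-- The normalising constant of the moment formula. It is found without oscillatory integrals by
integrating the scaling identity `setLIntegral_Ioi_comp_mul_mul_rpow` against the exponential law:
one side is a Gamma integral, the other a beta integral, and the reflection formula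
compares them. -/
theorem setLIntegral_Ioi_one_sub_cos_mul_rpow {lam : ℝ} (h0 : 0 < lam) (h1 : lam < 1) :
    ∫⁻ t in Ioi (0 : ℝ), ENNReal.ofReal ((1 - cos t) * t ^ (-1 - (1 + lam))) =
      ENNReal.ofReal (sin (lam * π / 2) * Gamma (1 - lam) / (lam * (1 + lam))) := by
  set p := 1 + lam with hp
  have hp0 : 0 < p := by linarith
  have key : ENNReal.ofReal (Gamma (p + 1)) *
      ∫⁻ t in Ioi (0 : ℝ), ENNReal.ofReal ((1 - cos t) * t ^ (-1 - p)) =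
      ENNReal.ofReal (1 / p * beta (1 - p / 2) (1 + p / 2)) := by
    calc _ = ∫⁻ y in Ioi (0 : ℝ), ∫⁻ t in Ioi (0 : ℝ),
          ENNReal.ofReal (exp (-y) * ((1 - cos (y * t)) * t ^ (-1 - p))) := by
          have hG := setLIntegral_Ioi_rpow_mul_exp_neg_mul (show 0 < p + 1 by linarith) one_pos
          simp only [div_one, one_rpow, one_mul] at hG
          rw [← hG, ← lintegral_mul_const _ (by fun_prop)]
          refine setLIntegral_congr_fun measurableSet_Ioi fun y hy => ?_
          have hy : 0 < y := hy
          simp_rw [ENNReal.ofReal_mul (exp_pos (-y)).le]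
          rw [lintegral_const_mul' _ _ ENNReal.ofReal_ne_top,
            setLIntegral_Ioi_comp_mul_mul_rpow (fun t => 1 - cos t) p hy, ← mul_assoc,
            ← ENNReal.ofReal_mul (exp_pos (-y)).le, add_sub_cancel_right, mul_comm (exp (-y))]
      _ = ∫⁻ t in Ioi (0 : ℝ), ∫⁻ y in Ioi (0 : ℝ),
          ENNReal.ofReal (exp (-y) * ((1 - cos (y * t)) * t ^ (-1 - p))) :=
          lintegral_lintegral_swap (by fun_prop)
      _ = ∫⁻ t in Ioi (0 : ℝ),
          ENNReal.ofReal ((1 - (1 + t ^ (2 : ℝ)) ^ (-1 : ℝ)) * t ^ (-1 - p)) := by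
          refine setLIntegral_congr_fun measurableSet_Ioi fun t ht => ?_
          have ht : 0 < t := ht
          rw [ENNReal.ofReal_mul' (by positivity), ← setLIntegral_Ioi_exp_neg_mul_one_sub_cos,
            ← lintegral_mul_const' _ _ ENNReal.ofReal_ne_top]
          refine lintegral_congr fun y => ?_
          rw [← ENNReal.ofReal_mul' (by positivity), mul_comm y t, mul_assoc]
      _ = _ := setLIntegral_Ioi_one_sub_mul_rpow one_pos hp0 (by linarith)
  have hG : 0 < Gamma (p + 1) := Gamma_pos_of_pos (by linarith)
  have h0' : ENNReal.ofReal (Gamma (p + 1)) ≠ 0 := by simpa using hG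
  rw [← ENNReal.mul_right_inj h0' ENNReal.ofReal_ne_top, key, ← ENNReal.ofReal_mul hG.le, beta]
  congr 1
  have e1 : Gamma (p + 1) = p * lam * Gamma lam := by
    rw [Gamma_add_one hp0.ne', hp, add_comm 1 lam, Gamma_add_one h0.ne']
    ring
  have e2 : Gamma (1 + p / 2) = p / 2 * Gamma (p / 2) := by
    rw [add_comm, Gamma_add_one (by positivity)]
  have e3 := Gamma_mul_Gamma_one_sub (p / 2)
  have e4 := Gamma_mul_Gamma_one_sub lam
  have e5 : sin (π * (p / 2)) = cos (lam * π / 2) := by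
    rw [← sin_add_pi_div_two, hp]
    congr 1
    ring
  have e6 : sin (π * lam) = 2 * sin (lam * π / 2) * cos (lam * π / 2) := by
    rw [← sin_two_mul]
    congr 1
    ring
  have hs : 0 < sin (lam * π / 2) :=
    sin_pos_of_pos_of_lt_pi (by positivity) (by nlinarith [pi_pos])
  have hc : 0 < cos (lam * π / 2) :=
    cos_pos_of_mem_Ioo ⟨by nlinarith [pi_pos], by nlinarith [pi_pos]⟩
  rw [e5] at e3
  rw [e6] at e4
  rw [show 1 - p / 2 + (1 + p / 2) = 1 + 1 by ring, Gamma_add_one one_ne_zero, Gamma_one, e1, e2]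
  calc _ = Gamma (p / 2) * Gamma (1 - p / 2) / 2 := by field_simp
    _ = Gamma lam * Gamma (1 - lam) * sin (lam * π / 2) := by
      generalize sin (lam * π / 2) = u at *
      generalize cos (lam * π / 2) = v at *
      rw [e3, e4]
      field_simp
    _ = _ := by field_simp

/-- Absolute moments from the characteristic function: `|y| ^ p` is a multiple of
`∫ t in Ioi 0, (1 - cos (t * y)) * t ^ (-1 - p)`, and the expectation is taken under the
integral. -/
theorem lintegral_abs_rpow_mul_eq {Ω : Type*} [MeasurableSpace Ω] (P : Measure Ω)
    [IsProbabilityMeasure P] {Y : Ω → ℝ} (hY : Measurable Y) {φ : ℝ → ℝ}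
    (hφ : ∀ t, ∫ ω, cos (t * Y ω) ∂P = φ t) {p : ℝ} (hp : 0 < p) :
    (∫⁻ ω, ENNReal.ofReal (|Y ω| ^ p) ∂P) *
        ∫⁻ t in Ioi (0 : ℝ), ENNReal.ofReal ((1 - cos t) * t ^ (-1 - p)) =
      ∫⁻ t in Ioi (0 : ℝ), ENNReal.ofReal ((1 - φ t) * t ^ (-1 - p)) := by
  have hcos : ∀ t, Integrable (fun ω => cos (t * Y ω)) P := fun t =>
    Integrable.of_bound (by fun_prop) 1 (ae_of_all _ fun ω => abs_cos_le_one _)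
  calc _ = ∫⁻ ω, (∫⁻ t in Ioi (0 : ℝ),
          ENNReal.ofReal ((1 - cos (t * Y ω)) * t ^ (-1 - p))) ∂P := by
        rw [← lintegral_mul_const _ (by fun_prop)]
        refine lintegral_congr fun ω => ?_
        rcases eq_or_ne (Y ω) 0 with h | h
        · simp [h, zero_rpow hp.ne']
        · rw [← setLIntegral_Ioi_comp_mul_mul_rpow (fun t => 1 - cos t) p (abs_pos.2 h)]
          refine setLIntegral_congr_fun measurableSet_Ioi fun t ht => ?_
          have ht : 0 < t := ht
          rw [← cos_abs (t * Y ω), abs_mul, abs_of_pos ht, mul_comm t]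
    _ = ∫⁻ t in Ioi (0 : ℝ), (∫⁻ ω, ENNReal.ofReal ((1 - cos (t * Y ω)) * t ^ (-1 - p)) ∂P) :=
        lintegral_lintegral_swap (by fun_prop)
    _ = _ := by
        refine setLIntegral_congr_fun measurableSet_Ioi fun t ht => ?_
        have ht : 0 < t := ht
        simp_rw [ENNReal.ofReal_mul' (rpow_nonneg ht.le (-1 - p))]
        rw [lintegral_mul_const' _ _ ENNReal.ofReal_ne_top, ← ofReal_integral_eq_lintegral_ofReal
          (f := fun ω => 1 - cos (t * Y ω)) ((integrable_const _).sub (hcos t)),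
          integral_sub (integrable_const _) (hcos t), hφ]
        · simp
        · exact ae_of_all _ fun ω => sub_nonneg.2 (cos_le_one _)

/-! ### Rotation invariant and symmetric laws in the plane -/

theorem map_prodMk_eq_of_integral_exp_eq {Ω : Type*} [MeasurableSpace Ω] (P : Measure Ω)
    [IsProbabilityMeasure P] {A B A' B' : Ω → ℝ} (hA : Measurable A) (hB : Measurable B)
    (hA' : Measurable A') (hB' : Measurable B')
    (h : ∀ s u : ℝ, ∫ ω, Complex.exp (((s * A ω + u * B ω : ℝ) : ℂ) * Complex.I) ∂P =
      ∫ ω, Complex.exp (((s * A' ω + u * B' ω : ℝ) : ℂ) * Complex.I) ∂P) :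
    P.map (fun ω => (A ω, B ω)) = P.map (fun ω => (A' ω, B' ω)) := by
  have : IsProbabilityMeasure (P.map fun ω => (A ω, B ω)) :=
    Measure.isProbabilityMeasure_map (by fun_prop)
  have : IsProbabilityMeasure (P.map fun ω => (A' ω, B' ω)) :=
    Measure.isProbabilityMeasure_map (by fun_prop)
  refine Measure.ext_of_charFunDual (funext fun L => ?_)
  have hL : ∀ x y : ℝ, L (x, y) = L (1, 0) * x + L (0, 1) * y := fun x y => by
    have hxy : ((x, y) : ℝ × ℝ) = x • ((1, 0) : ℝ × ℝ) + y • ((0, 1) : ℝ × ℝ) := by simp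
    rw [hxy, map_add, map_smul, map_smul, smul_eq_mul, smul_eq_mul]
    ring
  rw [charFunDual_apply, charFunDual_apply,
    integral_map (by fun_prop) (Measurable.aestronglyMeasurable (by fun_prop)),
    integral_map (by fun_prop) (Measurable.aestronglyMeasurable (by fun_prop))]
  have hL' := h (L (1, 0)) (L (0, 1))
  simp_rw [← hL] at hL'
  exact hL'

/-- As `θ` runs over a period, `r * cos θ` passes from `-r` to `r` and back, so the total
variation of `arctan (r * cos θ)` is at most `2 * π`, whatever `r` is; the integrand is the speed of
`arctan (r * cos θ)`, up to the sign of `r`. -/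
theorem integral_abs_sin_div_le (r : ℝ) :
    ∫ θ in (-π)..π, r * |sin θ| / (1 + (r * cos θ) ^ 2) ≤ 2 * π := by
  have hpos : ∀ θ : ℝ, 1 + (r * cos θ) ^ 2 ≠ 0 := fun θ => by positivity
  have hcont : Continuous fun θ : ℝ => r * |sin θ| / (1 + (r * cos θ) ^ 2) :=
    Continuous.div (by fun_prop) (by fun_prop) hpos
  have hcont' : Continuous fun θ : ℝ => r * sin θ / (1 + (r * cos θ) ^ 2) :=
    Continuous.div (by fun_prop) (by fun_prop) hpos
  have hd : ∀ θ : ℝ, HasDerivAt (fun θ => -arctan (r * cos θ))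
      (r * sin θ / (1 + (r * cos θ) ^ 2)) θ := fun θ =>
    ((hasDerivAt_cos θ).const_mul r).arctan.neg.congr_deriv (by ring)
  have hfwd : ∫ θ in (0 : ℝ)..π, r * |sin θ| / (1 + (r * cos θ) ^ 2) = 2 * arctan r := by
    rw [intervalIntegral.integral_congr (g := fun θ => r * sin θ / (1 + (r * cos θ) ^ 2)),
      intervalIntegral.integral_eq_sub_of_hasDerivAt (fun θ _ => hd θ)
        (hcont'.intervalIntegrable _ _)]
    · simp [arctan_neg]
      ring
    · intro θ hθ
      rw [uIcc_of_le pi_pos.le] at hθ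
      simp only [abs_of_nonneg (sin_nonneg_of_mem_Icc hθ)]
  have hbwd : ∫ θ in (-π)..0, r * |sin θ| / (1 + (r * cos θ) ^ 2) = 2 * arctan r := by
    have h := intervalIntegral.integral_comp_neg (a := 0) (b := π)
      fun θ => r * |sin θ| / (1 + (r * cos θ) ^ 2)
    simp only [sin_neg, cos_neg, abs_neg, neg_zero] at h
    rw [← h, hfwd]
  rw [← intervalIntegral.integral_add_adjacent_intervals (hcont.intervalIntegrable (-π) 0)
    (hcont.intervalIntegrable 0 π), hfwd, hbwd]
  linarith [arctan_lt_pi_div_two r]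

theorem setLIntegral_rotation_le (x w : ℝ) :
    ∫⁻ θ in Ioc (-π) π, ENNReal.ofReal
      (|-(sin θ * x) + cos θ * w| / (1 + (cos θ * x + sin θ * w) ^ 2)) ≤
      ENNReal.ofReal (2 * π) := by
  have hpos : ∀ θ : ℝ, 1 + (cos θ * x + sin θ * w) ^ 2 ≠ 0 := fun θ => by positivity
  have hcont : Continuous fun θ : ℝ =>
      |-(sin θ * x) + cos θ * w| / (1 + (cos θ * x + sin θ * w) ^ 2) :=
    Continuous.div (by fun_prop) (by fun_prop) hpos
  have hle : -π ≤ π := by linarith [pi_pos]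
  rw [← ofReal_integral_eq_lintegral_ofReal ((intervalIntegrable_iff_integrableOn_Ioc_of_le hle).1
    (hcont.intervalIntegrable _ _)) (ae_of_all _ fun θ => by positivity),
    ← intervalIntegral.integral_of_le hle]
  refine ENNReal.ofReal_le_ofReal ?_
  -- polar coordinates `x = r * cos a`, `w = r * sin a`
  set z : ℂ := ⟨x, w⟩
  set r := ‖z‖
  set a := z.arg
  have hx : x = r * cos a := (Complex.norm_mul_cos_arg z).symm
  have hw : w = r * sin a := (Complex.norm_mul_sin_arg z).symm
  have hr : 0 ≤ r := norm_nonneg z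
  have hf : ∀ θ : ℝ, |-(sin θ * x) + cos θ * w| / (1 + (cos θ * x + sin θ * w) ^ 2) =
      (fun φ => r * |sin φ| / (1 + (r * cos φ) ^ 2)) (θ - a) := fun θ => by
    have h1 : -(sin θ * x) + cos θ * w = -(r * sin (θ - a)) := by
      rw [sin_sub, hx, hw]; ring
    have h2 : cos θ * x + sin θ * w = r * cos (θ - a) := by
      rw [cos_sub, hx, hw]; ring
    rw [h1, h2, abs_neg, abs_mul, abs_of_nonneg hr]
  have hper : Function.Periodic (fun φ => r * |sin φ| / (1 + (r * cos φ) ^ 2)) (2 * π) :=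
    fun φ => by simp
  simp_rw [hf]
  rw [intervalIntegral.integral_comp_sub_right (fun φ => r * |sin φ| / (1 + (r * cos φ) ^ 2))]
  have h := hper.intervalIntegral_add_eq (-π - a) (-π)
  rw [show -π - a + 2 * π = π - a by ring, show -π + 2 * π = π by ring] at h
  rw [h]
  exact integral_abs_sin_div_le r

/-- For a rotation invariant law in the plane, the second coordinate becomes integrable after
damping in the first coordinate alone: averaging over all rotations bounds the expectation
by `1`. No moment assumption is made. -/
theorem integrable_div_one_add_sq_of_rotation_invariant {Ω : Type*} [MeasurableSpace Ω]
    (P : Measure Ω) [IsProbabilityMeasure P] {A W : Ω → ℝ} (hA : Measurable A) (hW : Measurable W)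
    (hrot : ∀ θ : ℝ, P.map (fun ω => (A ω, W ω)) =
      P.map (fun ω => (cos θ * A ω + sin θ * W ω, -(sin θ * A ω) + cos θ * W ω))) :
    Integrable (fun ω => W ω / (1 + A ω ^ 2)) P := by
  set F : ℝ × ℝ → ENNReal := fun q => ENNReal.ofReal (|q.2| / (1 + q.1 ^ 2)) with hF
  have hFm : Measurable F := by fun_prop
  set I := ∫⁻ ω, F (A ω, W ω) ∂P with hI
  have hIθ : ∀ θ : ℝ, I =
      ∫⁻ ω, F (cos θ * A ω + sin θ * W ω, -(sin θ * A ω) + cos θ * W ω) ∂P := fun θ => by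
    rw [hI, ← lintegral_map (μ := P) (g := fun ω => (A ω, W ω)) hFm (by fun_prop), hrot θ,
      lintegral_map hFm (by fun_prop)]
  have hbound : I * ENNReal.ofReal (2 * π) ≤ ENNReal.ofReal (2 * π) := by
    calc I * ENNReal.ofReal (2 * π) = ∫⁻ _ in Ioc (-π) π, I := by
          rw [setLIntegral_const, Real.volume_Ioc]
          congr 2
          ring
      _ = ∫⁻ θ in Ioc (-π) π,
            (∫⁻ ω, F (cos θ * A ω + sin θ * W ω, -(sin θ * A ω) + cos θ * W ω) ∂P) :=
          lintegral_congr fun θ => hIθ θ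
      _ = ∫⁻ ω, (∫⁻ θ in Ioc (-π) π,
            F (cos θ * A ω + sin θ * W ω, -(sin θ * A ω) + cos θ * W ω)) ∂P :=
          lintegral_lintegral_swap (by fun_prop)
      _ ≤ ∫⁻ _, ENNReal.ofReal (2 * π) ∂P :=
          lintegral_mono fun ω => setLIntegral_rotation_le (A ω) (W ω)
      _ = ENNReal.ofReal (2 * π) := by simp
  have hfin : I < ⊤ := by
    by_contra hcon
    rw [not_lt_top_iff.1 hcon, ENNReal.top_mul (by simp [pi_pos])] at hbound
    exact ENNReal.ofReal_ne_top (top_le_iff.1 hbound)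
  refine ⟨Measurable.aestronglyMeasurable (by fun_prop), ?_⟩
  rw [hasFiniteIntegral_iff_norm]
  convert hfin using 1
  rw [hI]
  refine lintegral_congr fun ω => ?_
  rw [hF, norm_eq_abs, abs_div, abs_of_pos (show 0 < 1 + A ω ^ 2 by positivity)]

/-- If the law of `(A, D)` is unchanged by `D ↦ -D` and `D` is integrable after damping by
a positive function of `A`, then the conditional law of `D + γ A` given `A` has mean `γ A`. -/
theorem condDistrib_mean_of_symm {Ω : Type*} [MeasurableSpace Ω] (P : Measure Ω)
    [IsProbabilityMeasure P] {A Y : Ω → ℝ} (hA : Measurable A) (hY : Measurable Y) (γ : ℝ)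
    (hsymm : P.map (fun ω => (A ω, Y ω - γ * A ω)) = P.map (fun ω => (A ω, -(Y ω - γ * A ω))))
    (hint : Integrable (fun ω => (Y ω - γ * A ω) / (1 + A ω ^ 2)) P) :
    ∀ᵐ ω ∂P, Integrable (fun y : ℝ => y) (condDistrib Y A P (A ω)) ∧
      ∫ y, y ∂(condDistrib Y A P (A ω)) = γ * A ω := by
  set f : ℝ × ℝ → ℝ := fun q => (q.2 - γ * q.1) / (1 + q.1 ^ 2) with hf
  have hfm : Measurable f := by fun_prop
  have hfint : Integrable f (P.map fun ω => (A ω, Y ω)) :=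
    (integrable_map_measure hfm.aestronglyMeasurable (by fun_prop)).2 hint
  have hzero : (fun _ => (0 : ℝ)) =ᵐ[P]
      P[fun ω => f (A ω, Y ω) | MeasurableSpace.comap A inferInstance] := by
    refine ae_eq_condExp_of_forall_setIntegral_eq hA.comap_le hint
      (fun _ _ _ => integrableOn_zero) ?_ aestronglyMeasurable_const
    rintro _ ⟨t, ht, rfl⟩ -
    set G : ℝ × ℝ → ℝ := (t ×ˢ univ).indicator fun q => q.2 / (1 + q.1 ^ 2) with hG
    have hGm : Measurable G :=
      Measurable.indicator (by fun_prop) (ht.prod MeasurableSet.univ)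
    have hGodd : ∀ x d : ℝ, G (x, -d) = -G (x, d) := fun x d => by
      by_cases hx : x ∈ t <;> simp [hG, hx, neg_div]
    have h1 : ∫ ω, G (A ω, Y ω - γ * A ω) ∂P = ∫ ω, G (A ω, -(Y ω - γ * A ω)) ∂P := by
      rw [← integral_map (μ := P) (φ := fun ω => (A ω, Y ω - γ * A ω)) (by fun_prop)
        hGm.aestronglyMeasurable, hsymm, integral_map (by fun_prop) hGm.aestronglyMeasurable]
    simp_rw [hGodd] at h1
    rw [integral_neg] at h1
    have h2 : ∫ ω in A ⁻¹' t, f (A ω, Y ω) ∂P = ∫ ω, G (A ω, Y ω - γ * A ω) ∂P := by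
      rw [← integral_indicator (hA ht)]
      refine integral_congr_ae (ae_of_all _ fun ω => ?_)
      by_cases hx : A ω ∈ t <;> simp [hG, hf, hx]
    rw [h2, integral_zero]
    linarith
  filter_upwards [hzero, condExp_prod_ae_eq_integral_condDistrib' hA hY.aemeasurable hfint,
    hfint.condDistrib_ae hA.aemeasurable hY.aemeasurable] with ω h0 h1 h2
  have hpos : 1 + A ω ^ 2 ≠ 0 := by positivity
  have hsub : Integrable (fun y => y - γ * A ω) (condDistrib Y A P (A ω)) := by
    refine (h2.mul_const (1 + A ω ^ 2)).congr (ae_of_all _ fun y => ?_)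
    simp only [hf]
    field_simp
  have hid : Integrable (fun y : ℝ => y) (condDistrib Y A P (A ω)) :=
    (hsub.add (integrable_const (γ * A ω))).congr (ae_of_all _ fun y => by simp)
  refine ⟨hid, ?_⟩
  rw [← h0] at h1
  simp only [hf] at h1
  rw [integral_div, integral_sub hid (integrable_const _), eq_comm, div_eq_zero_iff] at h1
  simpa [hpos, sub_eq_zero] using h1

/-! ### Bivariate Linnik vectors -/

namespace IsBivariateLinnik

variable {Ω : Type*} [MeasurableSpace Ω] {P : Measure Ω} {X₁ X₂ : Ω → ℝ} {α β γ : ℝ}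

theorem integral_exp (hX : IsBivariateLinnik P X₁ X₂ α β (corrMatrix γ)) (s u : ℝ) :
    ∫ ω, Complex.exp (((s * X₁ ω + u * X₂ ω : ℝ) : ℂ) * Complex.I) ∂P =
      (((1 + (s ^ 2 + 2 * γ * s * u + u ^ 2) ^ (α / 2)) ^ (-β) : ℝ) : ℂ) := by
  have h1 := hX.measurable_fst
  have h2 := hX.measurable_snd
  have hm : Measurable fun ω => (!₂[X₁ ω, X₂ ω] : EuclideanSpace ℝ (Fin 2)) := by
    refine (WithLp.measurable_toLp 2 (Fin 2 → ℝ)).comp (measurable_pi_iff.2 fun i => ?_)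
    fin_cases i <;> simpa
  have h := hX.charFun_eq !₂[s, u]
  have hq : ((!₂[s, u] : EuclideanSpace ℝ (Fin 2)) : Fin 2 → ℝ) ⬝ᵥ
      (corrMatrix γ *ᵥ ((!₂[s, u] : EuclideanSpace ℝ (Fin 2)) : Fin 2 → ℝ)) =
      s ^ 2 + 2 * γ * s * u + u ^ 2 := by
    simp [corrMatrix, Matrix.mulVec, dotProduct, Fin.sum_univ_two]
    ring
  rw [hq, charFun_apply, integral_map hm.aemeasurable
    (Measurable.aestronglyMeasurable (by fun_prop))] at h
  rw [← h]
  refine integral_congr_ae (ae_of_all _ fun ω => ?_)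
  simp [PiLp.inner_apply, Fin.sum_univ_two]

/-- In the coordinates `X₁` and `X₂ - γ X₁` the quadratic form is diagonal. -/
theorem integral_exp_residual (hX : IsBivariateLinnik P X₁ X₂ α β (corrMatrix γ)) (s u : ℝ) :
    ∫ ω, Complex.exp (((s * X₁ ω + u * (X₂ ω - γ * X₁ ω) : ℝ) : ℂ) * Complex.I) ∂P =
      (((1 + (s ^ 2 + (1 - γ ^ 2) * u ^ 2) ^ (α / 2)) ^ (-β) : ℝ) : ℂ) := by
  rw [show s ^ 2 + (1 - γ ^ 2) * u ^ 2 =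
    (s - γ * u) ^ 2 + 2 * γ * (s - γ * u) * u + u ^ 2 by ring, ← hX.integral_exp]
  refine integral_congr_ae (ae_of_all _ fun ω => ?_)
  dsimp only
  congr 3
  ring

variable [IsProbabilityMeasure P]

theorem map_residual_eq_map_neg (hX : IsBivariateLinnik P X₁ X₂ α β (corrMatrix γ)) :
    P.map (fun ω => (X₁ ω, X₂ ω - γ * X₁ ω)) = P.map (fun ω => (X₁ ω, -(X₂ ω - γ * X₁ ω))) := by
  have h1 := hX.measurable_fst
  have h2 := hX.measurable_snd
  refine map_prodMk_eq_of_integral_exp_eq P (by fun_prop) (by fun_prop) (by fun_prop)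
    (by fun_prop) fun s u => ?_
  have h := hX.integral_exp_residual s (-u)
  simp only [neg_mul, neg_sq] at h
  simp only [mul_neg]
  rw [h, hX.integral_exp_residual]

theorem integrable_residual_div (hX : IsBivariateLinnik P X₁ X₂ α β (corrMatrix γ))
    (hγ : |γ| ≤ 1) :
    Integrable (fun ω => (X₂ ω - γ * X₁ ω) / (1 + X₁ ω ^ 2)) P := by
  have h1 := hX.measurable_fst
  have h2 := hX.measurable_snd
  have hγ2 : γ ^ 2 ≤ 1 := (sq_le_one_iff_abs_le_one γ).2 hγ
  rcases hγ2.eq_or_lt with hone | hlt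
  · -- the degenerate case `X₂ = γ X₁` almost surely
    have hmap : P.map (fun ω => (X₁ ω, X₂ ω - γ * X₁ ω)) = P.map (fun ω => (X₁ ω, (0 : ℝ))) := by
      refine map_prodMk_eq_of_integral_exp_eq P (by fun_prop) (by fun_prop) (by fun_prop)
        (by fun_prop) fun s u => ?_
      have h := hX.integral_exp_residual s 0
      simp only [zero_mul] at h
      simp only [mul_zero]
      rw [h, hX.integral_exp_residual, hone]
      simp
    have hf : Measurable fun q : ℝ × ℝ => q.2 / (1 + q.1 ^ 2) := by fun_prop
    have hi : Integrable (fun q : ℝ × ℝ => q.2 / (1 + q.1 ^ 2))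
        (P.map (fun ω => (X₁ ω, X₂ ω - γ * X₁ ω))) := by
      rw [hmap, integrable_map_measure hf.aestronglyMeasurable (by fun_prop)]
      simp [Function.comp_def]
    exact (integrable_map_measure hf.aestronglyMeasurable (by fun_prop)).1 hi
  · set σ := √(1 - γ ^ 2) with hσ
    have hσ2 : σ ^ 2 = 1 - γ ^ 2 := sq_sqrt (by linarith)
    have hσ0 : 0 < σ := sqrt_pos.2 (by linarith)
    have hW : ∀ s u : ℝ,
        ∫ ω, Complex.exp (((s * X₁ ω + u * ((X₂ ω - γ * X₁ ω) / σ) : ℝ) : ℂ) * Complex.I) ∂P =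
        (((1 + (s ^ 2 + u ^ 2) ^ (α / 2)) ^ (-β) : ℝ) : ℂ) := fun s u => by
      have h := hX.integral_exp_residual s (u / σ)
      rw [← hσ2, div_pow, mul_div_cancel₀ _ (by positivity)] at h
      rw [← h]
      simp only [div_mul_eq_mul_div, mul_div_assoc]
    have hi := integrable_div_one_add_sq_of_rotation_invariant P h1
      (W := fun ω => (X₂ ω - γ * X₁ ω) / σ) (by fun_prop) fun θ => by
        refine map_prodMk_eq_of_integral_exp_eq P (by fun_prop) (by fun_prop) (by fun_prop)
          (by fun_prop) fun s u => ?_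
        have h := hW (s * cos θ - u * sin θ) (s * sin θ + u * cos θ)
        rw [hW, show s ^ 2 + u ^ 2 = (s * cos θ - u * sin θ) ^ 2 + (s * sin θ + u * cos θ) ^ 2 by
          linear_combination (-(s ^ 2 + u ^ 2)) * sin_sq_add_cos_sq θ, ← h]
        refine integral_congr_ae (ae_of_all _ fun ω => ?_)
        dsimp only
        congr 3
        ring
    refine (hi.const_mul σ).congr (ae_of_all _ fun ω => ?_)
    dsimp only
    field_simp

theorem condDistrib_mean (hX : IsBivariateLinnik P X₁ X₂ α β (corrMatrix γ))
    (hγ : |γ| ≤ 1) :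
    ∀ᵐ ω ∂P, Integrable (fun y : ℝ => y) (condDistrib X₂ X₁ P (X₁ ω)) ∧
      ∫ y, y ∂(condDistrib X₂ X₁ P (X₁ ω)) = γ * X₁ ω :=
  condDistrib_mean_of_symm P hX.measurable_fst hX.measurable_snd γ hX.map_residual_eq_map_neg
    (hX.integrable_residual_div hγ)

/-- In the degenerate case `c = γ = ±1` both sides vanish, since then `c ^ 2 - 2 * γ * c + 1 = 0`. -/
theorem abs_rpow_moment (hX : IsBivariateLinnik P X₁ X₂ α β (corrMatrix γ))
    (hα : α ≤ 2) (hβ : 0 < β) (hγ : |γ| ≤ 1) {lam : ℝ} (h0 : 0 < lam) (h1 : 1 + lam < α)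
    (c : ℝ) :
    Integrable (fun ω => |X₂ ω - c * X₁ ω| ^ (1 + lam)) P ∧
      ∫ ω, |X₂ ω - c * X₁ ω| ^ (1 + lam) ∂P =
        lam * β / (sin (lam * π / 2) * Gamma (1 - lam)) *
          |c ^ 2 - 2 * γ * c + 1| ^ ((1 + lam) / 2) *
          beta (1 - (1 + lam) / α) (β + (1 + lam) / α) := by
  have hm1 := hX.measurable_fst
  have hm2 := hX.measurable_snd
  have hlam : lam < 1 := by linarith
  have hα0 : 0 < α := by linarith
  have hγ2 : γ ^ 2 ≤ 1 := (sq_le_one_iff_abs_le_one γ).2 hγ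
  set p := 1 + lam with hp
  have hp0 : 0 < p := by linarith
  set q := c ^ 2 - 2 * γ * c + 1 with hq
  have hq0 : 0 ≤ q := by nlinarith [sq_nonneg (c - γ)]
  set σ := √q with hσ
  have hσ0 : 0 ≤ σ := sqrt_nonneg q
  set φ : ℝ → ℝ := fun t => (1 + |σ * t| ^ α) ^ (-β) with hφdef
  have hφ : ∀ t, ∫ ω, cos (t * (X₂ ω - c * X₁ ω)) ∂P = φ t := fun t => by
    have h := hX.integral_exp (-(t * c)) t
    have hqt : (-(t * c)) ^ 2 + 2 * γ * (-(t * c)) * t + t ^ 2 = |σ * t| ^ 2 := by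
      rw [sq_abs, mul_pow, sq_sqrt hq0]
      ring
    rw [hqt, ← rpow_natCast |σ * t| 2, ← rpow_mul (abs_nonneg _),
      show ((2 : ℕ) : ℝ) * (α / 2) = α by push_cast; ring] at h
    have hint : Integrable (fun ω => Complex.exp
        (((-(t * c) * X₁ ω + t * X₂ ω : ℝ) : ℂ) * Complex.I)) P :=
      Integrable.of_bound (Measurable.aestronglyMeasurable (by fun_prop)) 1
        (ae_of_all _ fun ω => (Complex.norm_exp_ofReal_mul_I _).le)
    have hre := integral_re hint
    simp only [RCLike.re_eq_complex_re, Complex.exp_ofReal_mul_I_re] at hre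
    rw [h, Complex.ofReal_re] at hre
    refine Eq.trans ?_ hre
    refine integral_congr_ae (ae_of_all _ fun ω => ?_)
    dsimp only
    congr 1
    ring
  have hY : Measurable fun ω => X₂ ω - c * X₁ ω := by fun_prop
  have hmain := lintegral_abs_rpow_mul_eq P hY hφ hp0
  rw [setLIntegral_Ioi_one_sub_cos_mul_rpow h0 hlam] at hmain
  set K := sin (lam * π / 2) * Gamma (1 - lam) / (lam * (1 + lam)) with hK
  have hs : 0 < sin (lam * π / 2) :=
    sin_pos_of_pos_of_lt_pi (by positivity) (by nlinarith [pi_pos])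
  have hG : 0 < Gamma (1 - lam) := Gamma_pos_of_pos (by linarith)
  have hK0 : 0 < K := by positivity
  have hpα : p / α < 1 := (div_lt_one hα0).2 h1
  have hB : 0 < beta (1 - p / α) (β + p / α) := beta_pos (by linarith) (by positivity)
  have hrhs : ∫⁻ t in Ioi (0 : ℝ), ENNReal.ofReal ((1 - φ t) * t ^ (-1 - p)) =
      ENNReal.ofReal (σ ^ p * (β / p * beta (1 - p / α) (β + p / α))) := by
    -- the change of variables `t ↦ σ * t` needs `σ ≠ 0`
    rcases hσ0.eq_or_lt with hz | hpos
    · simp [hφdef, ← hz, zero_rpow hp0.ne', zero_rpow hα0.ne']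
    · rw [ENNReal.ofReal_mul (by positivity), ← setLIntegral_Ioi_one_sub_mul_rpow hβ hp0 h1,
        ← setLIntegral_Ioi_comp_mul_mul_rpow (fun t => 1 - (1 + t ^ α) ^ (-β)) p hpos]
      refine setLIntegral_congr_fun measurableSet_Ioi fun t ht => ?_
      have ht : 0 < t := ht
      simp only [hφdef, abs_of_pos (mul_pos hpos ht)]
  rw [hrhs] at hmain
  have hval : ∫⁻ ω, ENNReal.ofReal (|X₂ ω - c * X₁ ω| ^ p) ∂P =
      ENNReal.ofReal (σ ^ p * (β / p * beta (1 - p / α) (β + p / α)) / K) := by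
    rw [ENNReal.ofReal_div_of_pos hK0, ← hmain,
      ENNReal.mul_div_cancel_right (by simpa using hK0) ENNReal.ofReal_ne_top]
  have hnn : ∀ ω, 0 ≤ |X₂ ω - c * X₁ ω| ^ p := fun ω => by positivity
  refine ⟨⟨Measurable.aestronglyMeasurable (by fun_prop), ?_⟩, ?_⟩
  · rw [hasFiniteIntegral_iff_ofReal (ae_of_all _ hnn), hval]
    exact ENNReal.ofReal_lt_top
  · rw [integral_eq_lintegral_of_nonneg_ae (ae_of_all _ hnn)
      (Measurable.aestronglyMeasurable (by fun_prop)), hval, ENNReal.toReal_ofReal (by positivity),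
      abs_of_nonneg hq0, hσ, sqrt_eq_rpow, ← rpow_mul hq0, show 1 / 2 * p = p / 2 by ring, hK,
      ← hp]
    field_simp

theorem integrable_snd (hX : IsBivariateLinnik P X₁ X₂ α β (corrMatrix γ))
    (hα₁ : 1 < α) (hα₂ : α ≤ 2) (hβ : 0 < β) (hγ : |γ| ≤ 1) : Integrable X₂ P := by
  -- any exponent strictly between `1` and `α` will do
  have h := (hX.abs_rpow_moment hα₂ hβ hγ (lam := (α - 1) / 2) (by linarith) (by linarith) 0).1
  refine ((integrable_const (1 : ℝ)).add h).mono' hX.measurable_snd.aestronglyMeasurable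
    (ae_of_all _ fun ω => ?_)
  simp only [Pi.add_apply, zero_mul, sub_zero, norm_eq_abs]
  rcases le_total |X₂ ω| 1 with hle | hle
  · have : 0 ≤ |X₂ ω| ^ (1 + (α - 1) / 2) := by positivity
    linarith
  · have := self_le_rpow_of_one_le hle (show 1 ≤ 1 + (α - 1) / 2 by linarith)
    linarith

end IsBivariateLinnik

end

theorem mainTheorem6 {Ω : Type*} [MeasurableSpace Ω] (P : Measure Ω) [IsProbabilityMeasure P]
    (X₁ X₂ : Ω → ℝ) (α β γ : ℝ) (hα₀ : 0 < α) (hα₂ : α ≤ 2) (hβ : 0 < β) (hγ : |γ| ≤ 1)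
    (hX : IsBivariateLinnik P X₁ X₂ α β (corrMatrix γ)) :
    -- the conditional law of `X₂` given `X₁` has a finite mean, equal to `γ X₁`
    (∀ᵐ ω ∂P, Integrable (fun y : ℝ => y) (condDistrib X₂ X₁ P (X₁ ω)) ∧
      ∫ y, y ∂(condDistrib X₂ X₁ P (X₁ ω)) = γ * X₁ ω) ∧
    -- for `1 < α`, `X₂` is integrable and its usual conditional expectation is `γ X₁`
    (1 < α → Integrable X₂ P ∧
      P[X₂ | MeasurableSpace.comap X₁ inferInstance] =ᵐ[P] fun ω => γ * X₁ ω) ∧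
    -- fractional moments of the errors of linear predictors and of the conditional mean
    (1 < α → α < 2 → ∀ lam : ℝ, 0 < lam → 1 + lam < α →
      (∀ c : ℝ,
        Integrable (fun ω => |X₂ ω - c * X₁ ω| ^ (1 + lam)) P ∧
        ∫ ω, |X₂ ω - c * X₁ ω| ^ (1 + lam) ∂P =
          lam * β / (Real.sin (lam * Real.pi / 2) * Real.Gamma (1 - lam)) *
            |c ^ 2 - 2 * γ * c + 1| ^ ((1 + lam) / 2) *
            beta (1 - (1 + lam) / α) (β + (1 + lam) / α)) ∧
      (Integrable
          (fun ω => |X₂ ω - (P[X₂ | MeasurableSpace.comap X₁ inferInstance]) ω| ^ (1 + lam)) P ∧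
        ∫ ω, |X₂ ω - (P[X₂ | MeasurableSpace.comap X₁ inferInstance]) ω| ^ (1 + lam) ∂P =
          lam * β / (Real.sin (lam * Real.pi / 2) * Real.Gamma (1 - lam)) *
            (1 - γ ^ 2) ^ ((1 + lam) / 2) *
            beta (1 - (1 + lam) / α) (β + (1 + lam) / α))) := by
  have hmean := hX.condDistrib_mean hγ
  have hcond : 1 < α → P[X₂ | MeasurableSpace.comap X₁ inferInstance] =ᵐ[P]
      fun ω => γ * X₁ ω := fun hα₁ => by
    filter_upwards [condExp_ae_eq_integral_condDistrib' hX.measurable_fst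
      (hX.integrable_snd hα₁ hα₂ hβ hγ), hmean] with ω h1 h2
    rw [h1, h2.2]
  refine ⟨hmean, fun hα₁ => ⟨hX.integrable_snd hα₁ hα₂ hβ hγ, hcond hα₁⟩,
    fun hα₁ _ lam h0 h1 => ⟨hX.abs_rpow_moment hα₂ hβ hγ h0 h1, ?_⟩⟩
  have hae : (fun ω => |X₂ ω - γ * X₁ ω| ^ (1 + lam)) =ᵐ[P] fun ω =>
      |X₂ ω - (P[X₂ | MeasurableSpace.comap X₁ inferInstance]) ω| ^ (1 + lam) := by
    filter_upwards [hcond hα₁] with ω h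
    rw [h]
  have hγ2 : γ ^ 2 ≤ 1 := (sq_le_one_iff_abs_le_one γ).2 hγ
  obtain ⟨hint, hval⟩ := hX.abs_rpow_moment hα₂ hβ hγ h0 h1 γ
  rw [show γ ^ 2 - 2 * γ * γ + 1 = 1 - γ ^ 2 by ring, abs_of_nonneg (by linarith)] at hval
  exact ⟨hint.congr hae, (integral_congr_ae hae).symm.trans hval⟩
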